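/- For a polynomial $f(z)=w_0\prod_{i=1}^{n}(z-\alpha_i)\in\mathbb{C}[z]$ with $w_0\neq 0$ let $\mu(f)=|w_0|\prod_{i=1}^{n}\max\{1,|\alpha_i|\}$ be its Mahler measure, and let $\mu(0)=0$. For an integer $d\ge 0$ let $V_d$ be the $(d+1)$-dimensional Lebesgue volume of the set $$\mathcal{U}_d=\{f\in\mathbb{R}[z] : \deg f\le d,\ \mu(f)\le 1\}\subset\mathbb{R}^{d+1},$$ where a polynomial is identified with its vector of coefficients, and put $$P(d)=\prod_{j=0}^{d}\binom dj,\qquad A(d)=\sum_{k=0}^{d}P(k)P(d-k),\qquad C_{0,0}(d)=\prod_{j=0}^{d}\left(2\binom dj+1\right),$$ $$\kappa_0(d)=4^{d+1}A(d)\left(d\binom{d}{\lfloor d/2\rfloor}+1\right)^{d}.$$ For real $T$ let $\mathcal{M}^1(d,T)$ be the number of primitive polynomials in $\mathbb{Z}[z]$ (the greatest common divisor of the coefficients is $1$) of degree exactly $d$ with Mahler measure at most $T$. Theorem. For all integers $d\ge 2$ and all real $T\ge 1$, $$\left|\mathcal{M}^1(d,T)-\frac{V_d}{\zeta(d+1)}T^{d+1}\right|\le\left(\frac{V_d}{d}+1\right)T+\big(C_{0,0}(d-1)+\zeta(d)\kappa_0(d)\big)T^{d},$$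 where $\zeta$ is the Riemann zeta function. -/

import Mathlib

open Polynomial MeasureTheory

namespace MahlerCount

/-- The real polynomial of degree at most `d` with coefficient vector `w`, the entry `w i` being
the coefficient of `z ^ i`. -/
noncomputable def polyOfVec (d : ℕ) (w : Fin (d + 1) → ℝ) : ℝ[X] :=
  ∑ i : Fin (d + 1), C (w i) * X ^ (i : ℕ)

/-- The unit star body `U_d`: real polynomials of degree at most `d` and Mahler measure at most `1`,
as a subset of `ℝ ^ (d + 1)`. -/
def unitStarBody (d : ℕ) : Set (Fin (d + 1) → ℝ) :=
  {w | ((polyOfVec d w).map (algebraMap ℝ ℂ)).mahlerMeasure ≤ 1}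

/-- `V_d`, the `(d + 1)`-dimensional Lebesgue volume of `U_d`. -/
noncomputable def V (d : ℕ) : ℝ := (volume (unitStarBody d)).toReal

/-- `P(d) = ∏_{j=0}^d (d choose j)`. -/
def P (d : ℕ) : ℕ := ∏ j ∈ Finset.range (d + 1), d.choose j

/-- `A(d) = ∑_{k=0}^d P(k) P(d-k)`. -/
def A (d : ℕ) : ℕ := ∑ k ∈ Finset.range (d + 1), P k * P (d - k)

/-- `κ_0(d) = 4^(d+1) A(d) (d (d choose ⌊d/2⌋) + 1)^d`. -/
def kappa0 (d : ℕ) : ℕ := 4 ^ (d + 1) * A d * (d * d.choose (d / 2) + 1) ^ d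

/-- `C_{m,n}(d) = ∏_{j=m}^{d-n} (2 (d choose j) + 1)`, for `m + n ≤ d`. -/
def Cmn (m n d : ℕ) : ℕ := ∏ j ∈ Finset.Icc m (d - n), (2 * d.choose j + 1)

/-- Primitive integer polynomials of degree exactly `d` and Mahler measure at most `T`. -/
def primitivePolys (d : ℕ) (T : ℝ) : Set ℤ[X] :=
  {f | f.degree = d ∧ f.IsPrimitive ∧ (f.map (Int.castRingHom ℂ)).mahlerMeasure ≤ T}

/-- `M¹(d, T)`, the number of primitive integer polynomials of degree exactly `d` and Mahler measure
at most `T`. -/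
noncomputable def M1 (d : ℕ) (T : ℝ) : ℕ := (primitivePolys d T).ncard

theorem primitivePolys_finite (d : ℕ) (T : ℝ) : (primitivePolys d T).Finite := by
  refine (finite_mahlerMeasure_le d T.toNNReal).subset ?_
  rintro f ⟨h1, -, h3⟩
  exact ⟨(natDegree_eq_of_degree_eq_some h1).le, h3.trans (Real.le_coe_toNNReal T)⟩

theorem volume_unitStarBody_lt_top (d : ℕ) : volume (unitStarBody d) < ⊤ := by
  refine lt_of_le_of_lt (measure_mono (t := Metric.closedBall 0 (2 ^ d)) ?_)
    measure_closedBall_lt_top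
  intro w hw
  rw [mem_closedBall_zero_iff, pi_norm_le_iff_of_nonneg (by positivity)]
  intro i
  have hc : (polyOfVec d w).coeff i = w i := by
    simp only [polyOfVec, finsetSum_coeff, coeff_C_mul_X_pow]
    rw [Finset.sum_eq_single i] <;> simp +contextual [Fin.ext_iff, eq_comm]
  have hd : ((polyOfVec d w).map (algebraMap ℝ ℂ)).natDegree ≤ d := by
    refine natDegree_map_le.trans (natDegree_sum_le_of_forall_le _ _ fun j _ => ?_)
    exact (natDegree_C_mul_X_pow_le _ _).trans (Nat.lt_succ_iff.mp j.2)
  have h := norm_coeff_le_choose_mul_mahlerMeasure i ((polyOfVec d w).map (algebraMap ℝ ℂ))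
  rw [coeff_map, hc] at h
  simp only [Complex.coe_algebraMap, Complex.norm_real] at h
  refine h.trans ((mul_le_of_le_one_right (by positivity) hw).trans ?_)
  exact_mod_cast (Nat.choose_le_two_pow _ _).trans (Nat.pow_le_pow_right (by norm_num) hd)

end MahlerCount

namespace MahlerCount

/-! Integer polynomials of degree at most `d` with Mahler measure at most `T` are the lattice points
of `T • U_d`. Their number differs from the volume `V d * T ^ (d + 1)` by at most the number of unit
cubes meeting both the body and its complement, and by continuity of the measure each such cube
contains a point of measure exactly `T` (`isBoundaryCube_of_nonempty`).

These cubes are few because every real polynomial is `c * g * h`, with `g` monic carrying the roots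
in the closed unit disc, `h` of constant term one carrying the others, and both of measure one
(`hasSplitting`). On the boundary `|c| = T`, and `g`, `h` have only `d` free coefficients, bounded
by binomials. Cutting their ranges into cells of side `1 / N`, with `N` of order `T`, bounds the
number of cubes by `kappa0 d * T ^ d` (`HasLabel.unique`).

Möbius inversion over the content then counts primitive polynomials: the main terms sum to `V d /
ζ(d + 1)`, the errors to a `ζ(d)` term, and discarding the zero polynomial for each `n ≤ T` costs at
most `T`. Degrees below `d` are removed by a crude coefficient bound. -/

/-! ### Continuity of the Mahler measure in the coefficients -/

theorem continuous_coeff_mul {α : Type*} [TopologicalSpace α] {p q : α → ℂ[X]}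
    (hp : ∀ n, Continuous fun x => (p x).coeff n) (hq : ∀ n, Continuous fun x => (q x).coeff n)
    (n : ℕ) : Continuous fun x => (p x * q x).coeff n := by
  simp only [coeff_mul]
  exact continuous_finsetSum _ fun i _ => (hp _).mul (hq _)

theorem continuous_coeff_prod {α ι : Type*} [TopologicalSpace α] (s : Finset ι) {p : ι → α → ℂ[X]}
    (hp : ∀ i n, Continuous fun x => (p i x).coeff n) (n : ℕ) :
    Continuous fun x => (∏ i ∈ s, p i x).coeff n := by
  classical
  induction s using Finset.induction_on generalizing n with
  | empty => simpa using continuous_const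
  | insert i s hi ih =>
    simp only [Finset.prod_insert hi]
    exact continuous_coeff_mul (hp i) ih n

/-- The value is the sup norm of `(a, b)`, so linear factors of measure one form the unit sphere of
`ℂ × ℂ`, a compact space. -/
theorem mahlerMeasure_linear (a b : ℂ) : (C a * X + C b).mahlerMeasure = max ‖a‖ ‖b‖ := by
  by_cases ha : a = 0
  · simp [ha]
  · exact mahlerMeasure_C_mul_X_add_C ha b

/-- The product of a constant and `d` linear factors normalized to Mahler measure one. -/
noncomputable def linearProd (d : ℕ) (x : ℂ × (Fin d → Metric.sphere (0 : ℂ × ℂ) 1)) : ℂ[X] :=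
  C x.1 * ∏ i, (C (x.2 i).1.1 * X + C (x.2 i).1.2)

theorem mahlerMeasure_linearProd (d : ℕ) (x : ℂ × (Fin d → Metric.sphere (0 : ℂ × ℂ) 1)) :
    (linearProd d x).mahlerMeasure = ‖x.1‖ := by
  have h : ∀ i, (C (x.2 i).1.1 * X + C (x.2 i).1.2).mahlerMeasure = 1 := fun i => by
    rw [mahlerMeasure_linear]
    have := (x.2 i).2
    rwa [mem_sphere_zero_iff_norm, Prod.norm_def] at this
  rw [linearProd, mahlerMeasure_mul, mahlerMeasure_const, Finset.prod_eq_multiset_prod,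
    prod_mahlerMeasure_eq_mahlerMeasure_prod, Multiset.map_map]
  simp [h]

theorem natDegree_linearProd_le (d : ℕ) (x : ℂ × (Fin d → Metric.sphere (0 : ℂ × ℂ) 1)) :
    (linearProd d x).natDegree ≤ d := by
  refine (natDegree_C_mul_le _ _).trans ((natDegree_prod_le _ _).trans ?_)
  refine (Finset.sum_le_card_nsmul _ _ 1 fun i _ => natDegree_linear_le).trans (by simp)

theorem exists_eq_linear (α : ℂ) : ∃ (c : ℂ) (s : Metric.sphere (0 : ℂ × ℂ) 1),
    X - C α = C c * (C s.1.1 * X + C s.1.2) := by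
  have hm : 0 < max 1 ‖α‖ := lt_of_lt_of_le one_pos (le_max_left _ _)
  have hm' : ((max 1 ‖α‖ : ℝ) : ℂ) ≠ 0 := by exact_mod_cast hm.ne'
  refine ⟨(max 1 ‖α‖ : ℝ), ⟨(((max 1 ‖α‖ : ℝ) : ℂ)⁻¹ • ((1 : ℂ), -α)), ?_⟩, ?_⟩
  · rw [mem_sphere_zero_iff_norm, norm_smul, norm_inv, Complex.norm_real, Real.norm_of_nonneg hm.le,
      Prod.norm_def, norm_one, norm_neg, inv_mul_cancel₀ hm.ne']
  · simp only [Prod.smul_mk, smul_eq_mul, mul_one, mul_add, ← mul_assoc, ← map_mul,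
      mul_inv_cancel₀ hm', one_mul, map_neg, mul_neg]
    simp [sub_eq_add_neg]

theorem exists_eq_linearProd (d : ℕ) (p : ℂ[X]) (hp : p.natDegree ≤ d) :
    ∃ x, p = linearProd d x := by
  induction d generalizing p with
  | zero =>
    refine ⟨(p.coeff 0, Fin.elim0), ?_⟩
    rw [linearProd, Finset.univ_eq_empty, Finset.prod_empty, mul_one]
    exact eq_C_of_natDegree_le_zero hp
  | succ d ih =>
    rcases hp.lt_or_eq with h | h
    · obtain ⟨x, rfl⟩ := ih p (by omega)
      -- The pair `(0, 1)` is the constant factor 1, a root at infinity that pads the degree.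
      refine ⟨(x.1, Fin.cons ⟨((0 : ℂ), (1 : ℂ)), by simp⟩ x.2), ?_⟩
      simp [linearProd, Fin.prod_univ_succ]
    · obtain ⟨α, hα⟩ := Complex.exists_root (f := p)
        (natDegree_pos_iff_degree_pos.mp (by omega))
      obtain ⟨q, rfl⟩ := dvd_iff_isRoot.mpr hα
      have hq : q ≠ 0 := by rintro rfl; simp at h
      rw [natDegree_mul (X_sub_C_ne_zero α) hq, natDegree_X_sub_C] at h
      obtain ⟨x, rfl⟩ := ih q (by omega)
      obtain ⟨c, s, hs⟩ := exists_eq_linear α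
      refine ⟨(c * x.1, Fin.cons s x.2), ?_⟩
      rw [hs]
      simp only [linearProd, Fin.prod_univ_succ, Fin.cons_zero, Fin.cons_succ, map_mul]
      ring

/-- The complex polynomial with a given vector of coefficients. -/
noncomputable def complexPoly (d : ℕ) (w : Fin (d + 1) → ℂ) : ℂ[X] :=
  ∑ i : Fin (d + 1), C (w i) * X ^ (i : ℕ)

theorem coeff_complexPoly (d : ℕ) (w : Fin (d + 1) → ℂ) (i : Fin (d + 1)) :
    (complexPoly d w).coeff i = w i := by
  simp only [complexPoly, finsetSum_coeff, coeff_C_mul_X_pow]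
  rw [Finset.sum_eq_single i] <;> simp +contextual [Fin.ext_iff, eq_comm]

theorem natDegree_complexPoly_le (d : ℕ) (w : Fin (d + 1) → ℂ) :
    (complexPoly d w).natDegree ≤ d :=
  natDegree_sum_le_of_forall_le _ _ fun j _ =>
    (natDegree_C_mul_X_pow_le _ _).trans (Nat.lt_succ_iff.mp j.2)

theorem complexPoly_coeff (d : ℕ) (p : ℂ[X]) (hp : p.natDegree ≤ d) :
    complexPoly d (fun i => p.coeff i) = p := by
  rw [complexPoly, Fin.sum_univ_eq_sum_range (fun i => C (p.coeff i) * X ^ i)]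
  exact (as_sum_range_C_mul_X_pow' p (Nat.lt_succ_of_le hp)).symm

/-- Multiplying out normalized factors is a proper continuous surjection, hence a quotient map, and
along it the measure becomes `‖x.1‖`. This avoids following individual roots. -/
theorem continuous_mahlerMeasure_complexPoly (d : ℕ) :
    Continuous fun w : Fin (d + 1) → ℂ => (complexPoly d w).mahlerMeasure := by
  set Φ : ℂ × (Fin d → Metric.sphere (0 : ℂ × ℂ) 1) → (Fin (d + 1) → ℂ) :=
    fun x i => (linearProd d x).coeff i with hΦ
  have hΦp : ∀ x, complexPoly d (Φ x) = linearProd d x := fun x =>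
    complexPoly_coeff d _ (natDegree_linearProd_le d x)
  have hcont : Continuous Φ := by
    refine continuous_pi fun i => continuous_coeff_mul (fun n => ?_)
      (continuous_coeff_prod _ fun j n => ?_) i
    · simp only [coeff_C]
      split_ifs <;> fun_prop
    · simp only [coeff_add, coeff_C_mul, coeff_C]
      split_ifs <;> fun_prop
  have hsurj : Function.Surjective Φ := fun w => by
    obtain ⟨x, hx⟩ := exists_eq_linearProd d _ (natDegree_complexPoly_le d w)
    exact ⟨x, funext fun i => by rw [hΦ, ← coeff_complexPoly d w i, hx]⟩
  have hproper : IsProperMap Φ := by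
    refine isProperMap_iff_isCompact_preimage.mpr ⟨hcont, fun K hK => ?_⟩
    obtain ⟨R, hR⟩ := hK.isBounded.exists_norm_le
    -- Only the scalar can escape to infinity, and its norm is the measure, at most the sum of the
    -- `d + 1` coefficient norms.
    refine IsCompact.of_isClosed_subset
      ((isCompact_closedBall (0 : ℂ) ((d + 1 : ℕ) * R)).prod isCompact_univ)
      (hK.isClosed.preimage hcont) fun x hx => ⟨?_, trivial⟩
    rw [mem_closedBall_zero_iff, ← mahlerMeasure_linearProd d x]
    refine (mahlerMeasure_le_sum_norm_coeff _).trans ?_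
    rw [sum_over_range' _ (by simp) (d + 1) (Nat.lt_succ_of_le (natDegree_linearProd_le d x)),
      ← Fin.sum_univ_eq_sum_range (fun i => ‖(linearProd d x).coeff i‖)]
    refine (Finset.sum_le_card_nsmul _ _ R fun i _ => ?_).trans (by simp)
    exact (norm_le_pi_norm (Φ x) i).trans (hR _ hx)
  rw [(hproper.isClosedMap.isQuotientMap hcont hsurj).continuous_iff]
  simp only [Function.comp_def, hΦp, mahlerMeasure_linearProd]
  fun_prop

/-! ### Splitting a real polynomial at the unit circle -/

/-- The Mahler measure of a real polynomial. -/
noncomputable abbrev realMahler (f : ℝ[X]) : ℝ := (f.map (algebraMap ℝ ℂ)).mahlerMeasure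

theorem map_polyOfVec (d : ℕ) (w : Fin (d + 1) → ℝ) :
    (polyOfVec d w).map (algebraMap ℝ ℂ) = complexPoly d fun i => (w i : ℂ) := by
  simp [polyOfVec, complexPoly, Polynomial.map_sum]

theorem continuous_realMahler (d : ℕ) : Continuous fun w => realMahler (polyOfVec d w) := by
  simp only [realMahler, map_polyOfVec]
  exact (continuous_mahlerMeasure_complexPoly d).comp
    (continuous_pi fun i => Complex.continuous_ofReal.comp (continuous_apply i))

theorem realMahler_mul (f g : ℝ[X]) : realMahler (f * g) = realMahler f * realMahler g := by
  rw [realMahler, Polynomial.map_mul, mahlerMeasure_mul]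

theorem realMahler_C (c : ℝ) : realMahler (C c) = |c| := by
  simp [realMahler]

theorem coeff_polyOfVec (d : ℕ) (w : Fin (d + 1) → ℝ) (i : Fin (d + 1)) :
    (polyOfVec d w).coeff i = w i := by
  simp only [polyOfVec, finsetSum_coeff, coeff_C_mul_X_pow]
  rw [Finset.sum_eq_single i] <;> simp +contextual [Fin.ext_iff, eq_comm]

theorem natDegree_polyOfVec_le (d : ℕ) (w : Fin (d + 1) → ℝ) : (polyOfVec d w).natDegree ≤ d :=
  natDegree_sum_le_of_forall_le _ _ fun j _ =>
    (natDegree_C_mul_X_pow_le _ _).trans (Nat.lt_succ_iff.mp j.2)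

theorem abs_coeff_le_choose_mul_realMahler {n : ℕ} {f : ℝ[X]} (hf : f.natDegree ≤ n) (i : ℕ) :
    |f.coeff i| ≤ n.choose i * realMahler f := by
  have h := norm_coeff_le_choose_mul_mahlerMeasure i (f.map (algebraMap ℝ ℂ))
  rw [coeff_map, Complex.coe_algebraMap, Complex.norm_real, Real.norm_eq_abs] at h
  refine h.trans (mul_le_mul_of_nonneg_right ?_ (mahlerMeasure_nonneg _))
  exact_mod_cast Nat.choose_le_choose i (natDegree_map_le.trans hf)

/-- The roots are Galois conjugate over `ℝ`, and the only automorphisms are the identity and complex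
conjugation. -/
theorem norm_root_eq_of_irreducible {p : ℝ[X]} (hp : Irreducible p) {a b : ℂ}
    (ha : aeval a p = 0) (hb : aeval b p = 0) : ‖a‖ = ‖b‖ := by
  have h : IsConjRoot ℝ a b := by
    rw [IsConjRoot, ← minpoly.eq_of_irreducible hp ha, ← minpoly.eq_of_irreducible hp hb]
  have : IsAlgClosure ℝ ℂ := ⟨inferInstance, inferInstance⟩
  have : Normal ℝ ℂ := IsAlgClosure.normal ℝ ℂ
  obtain ⟨σ, hσ⟩ := (isConjRoot_iff_exists_algEquiv).mp h
  rcases Complex.real_algHom_eq_id_or_conj (σ : ℂ →ₐ[ℝ] ℂ) with h' | h'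
  · have : σ b = b := congrArg (fun f : ℂ →ₐ[ℝ] ℂ => f b) h'
    rw [← hσ, this]
  · have : σ b = (starRingEnd ℂ) b := congrArg (fun f : ℂ →ₐ[ℝ] ℂ => f b) h'
    rw [← hσ, this, Complex.norm_conj]

/-- `f` is a constant times a monic polynomial of Mahler measure one times a polynomial of Mahler
measure one with constant coefficient one. -/
def HasSplitting (f : ℝ[X]) : Prop :=
  ∃ (c : ℝ) (g h : ℝ[X]), f = C c * (g * h) ∧ g.Monic ∧ h.coeff 0 = 1 ∧ realMahler g = 1 ∧
    realMahler h = 1 ∧ g.natDegree + h.natDegree = f.natDegree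

theorem HasSplitting.mul {f₁ f₂ : ℝ[X]} (h₁ : HasSplitting f₁) (h₂ : HasSplitting f₂)
    (hf₁ : f₁ ≠ 0) (hf₂ : f₂ ≠ 0) : HasSplitting (f₁ * f₂) := by
  obtain ⟨c₁, g₁, k₁, e₁, m₁, z₁, a₁, b₁, n₁⟩ := h₁
  obtain ⟨c₂, g₂, k₂, e₂, m₂, z₂, a₂, b₂, n₂⟩ := h₂
  have hk₁ : k₁ ≠ 0 := by rintro rfl; simp at z₁
  have hk₂ : k₂ ≠ 0 := by rintro rfl; simp at z₂
  refine ⟨c₁ * c₂, g₁ * g₂, k₁ * k₂, ?_, m₁.mul m₂, ?_, ?_, ?_, ?_⟩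
  · rw [e₁, e₂, map_mul]; ring
  · rw [mul_coeff_zero, z₁, z₂, one_mul]
  · rw [realMahler_mul, a₁, a₂, one_mul]
  · rw [realMahler_mul, b₁, b₂, one_mul]
  · rw [natDegree_mul hf₁ hf₂, natDegree_mul hk₁ hk₂, m₁.natDegree_mul m₂]
    omega

theorem hasSplitting_C (c : ℝ) : HasSplitting (C c) :=
  ⟨c, 1, 1, by simp, monic_one, by simp, by simp [realMahler], by simp [realMahler], by simp⟩

/-- All roots have the same absolute value. If it is at most 1, the measure is the absolute leading
coefficient and the normalized `p` serves as `g`; otherwise it is the absolute constant coefficient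
and the normalized `p` serves as `h`. -/
theorem hasSplitting_of_irreducible {p : ℝ[X]} (hp : Irreducible p) : HasSplitting p := by
  have hp0 := hp.ne_zero
  set q : ℂ[X] := p.map (algebraMap ℝ ℂ) with hq
  have hq0 : q ≠ 0 := (Polynomial.map_ne_zero_iff (algebraMap ℝ ℂ).injective).mpr hp0
  have hroot : ∀ a ∈ q.roots, aeval a p = 0 := fun a ha => by
    have := (mem_roots hq0).mp ha
    rwa [IsRoot, hq, eval_map_algebraMap] at this
  have hμ := mahlerMeasure_eq_leadingCoeff_mul_prod_roots q
  by_cases h : ∀ a ∈ q.roots, ‖a‖ ≤ 1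
  · have hlc : p.leadingCoeff ≠ 0 := leadingCoeff_ne_zero.mpr hp0
    have e : p = C p.leadingCoeff * (C p.leadingCoeff⁻¹ * p) := by
      rw [← mul_assoc, ← map_mul, mul_inv_cancel₀ hlc, map_one, one_mul]
    rw [Multiset.map_congr rfl (g := fun _ => (1 : ℝ)) (fun a ha => max_eq_left (h a ha))] at hμ
    simp only [Multiset.map_const', Multiset.prod_replicate, one_pow, mul_one] at hμ
    rw [hq, leadingCoeff_map, Complex.coe_algebraMap, Complex.norm_real, Real.norm_eq_abs] at hμ
    refine ⟨p.leadingCoeff, C p.leadingCoeff⁻¹ * p, 1, by rw [mul_one]; exact e, ?_, by simp, ?_,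
      by simp [realMahler], ?_⟩
    · rw [Monic, leadingCoeff_mul, leadingCoeff_C, inv_mul_cancel₀ hlc]
    · rw [realMahler_mul, realMahler_C, realMahler, hμ, abs_inv,
        inv_mul_cancel₀ (abs_ne_zero.mpr hlc)]
    · rw [natDegree_C_mul (inv_ne_zero hlc), natDegree_one, add_zero]
  · push Not at h
    obtain ⟨a, ha, ha1⟩ := h
    have h1 : ∀ b ∈ q.roots, max 1 ‖b‖ = ‖b‖ := fun b hb => by
      rw [norm_root_eq_of_irreducible hp (hroot b hb) (hroot a ha), max_eq_right ha1.le]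
    have hc : ‖q.coeff 0‖ = ‖q.leadingCoeff‖ * (q.roots.map fun b => ‖b‖).prod := by
      rw [(IsAlgClosed.splits q).coeff_zero_eq_leadingCoeff_mul_prod_roots, norm_mul, norm_mul,
        norm_pow, norm_neg, norm_one, one_pow, one_mul]
      congr 1
      exact map_multiset_prod (normHom : ℂ →*₀ ℝ) q.roots
    rw [Multiset.map_congr rfl h1, ← hc, hq, coeff_map, Complex.coe_algebraMap, Complex.norm_real,
      Real.norm_eq_abs] at hμ
    have hc0 : p.coeff 0 ≠ 0 := by
      have := mahlerMeasure_pos_of_ne_zero hq0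
      rw [hq, hμ] at this
      exact abs_pos.mp this
    have e : p = C (p.coeff 0) * (C (p.coeff 0)⁻¹ * p) := by
      rw [← mul_assoc, ← map_mul, mul_inv_cancel₀ hc0, map_one, one_mul]
    refine ⟨p.coeff 0, 1, C (p.coeff 0)⁻¹ * p, by rw [one_mul]; exact e, monic_one, ?_,
      by simp [realMahler], ?_, ?_⟩
    · rw [coeff_C_mul, inv_mul_cancel₀ hc0]
    · rw [realMahler_mul, realMahler_C, realMahler, hμ, abs_inv,
        inv_mul_cancel₀ (abs_ne_zero.mpr hc0)]
    · rw [natDegree_C_mul (inv_ne_zero hc0), natDegree_one, zero_add]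

theorem hasSplitting (f : ℝ[X]) : HasSplitting f := by
  induction f using WfDvdMonoid.induction_on_irreducible with
  | zero => simpa using hasSplitting_C 0
  | unit u hu =>
    obtain ⟨c, -, rfl⟩ := Polynomial.isUnit_iff.mp hu
    exact hasSplitting_C c
  | mul a i ha hi ih => exact (hasSplitting_of_irreducible hi).mul ih hi.ne_zero ha

/-! ### Counting the cubes that meet the boundary -/

/-- The integer cube `[z, z + 1]` contains a coefficient vector of Mahler measure exactly `T`. -/
def IsBoundaryCube (d : ℕ) (T : ℝ) (z : Fin (d + 1) → ℤ) : Prop :=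
  ∃ p : Fin (d + 1) → ℝ, (∀ i, (z i : ℝ) ≤ p i ∧ p i ≤ z i + 1) ∧ realMahler (polyOfVec d p) = T

/-- Labels for boundary cubes: a degree, a sign, cells of side `1 / N` for the coefficients of the
two factors, and the parities of the corner of the cube. -/
abbrev CubeLabel (d N : ℕ) : Type :=
  (k : Fin (d + 1)) × (Bool × ((j : Fin k) → Fin (2 * (k : ℕ).choose j * N)) ×
    ((j : Fin (d - k)) → Fin (2 * (d - k).choose (j + 1) * N)) × (Fin (d + 1) → Bool))

/-- The power of 4 collects one sign, `d + 1` parities and a factor 2 from each of the `k + (d - k)`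
cell ranges. -/
theorem card_cubeLabel (d N : ℕ) : Fintype.card (CubeLabel d N) = 4 ^ (d + 1) * A d * N ^ d := by
  have hP : ∀ k, ∏ j ∈ Finset.range k, k.choose j = P k := fun k => by
    rw [P, Finset.prod_range_succ, Nat.choose_self, mul_one]
  have hP' : ∀ k, ∏ j ∈ Finset.range k, k.choose (j + 1) = P k := fun k => by
    rw [P, Finset.prod_range_succ', Nat.choose_zero_right, mul_one]
  simp only [CubeLabel, Fintype.card_sigma, Fintype.card_prod, Fintype.card_pi, Fintype.card_fin,
    Fintype.card_bool, Finset.prod_const, Finset.card_univ]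
  simp only [fun k : ℕ => Fin.prod_univ_eq_prod_range (fun j => 2 * k.choose j * N) k,
    fun k : ℕ => Fin.prod_univ_eq_prod_range (fun j => 2 * k.choose (j + 1) * N) k]
  rw [Fin.sum_univ_eq_sum_range (fun k => 2 * ((∏ j ∈ Finset.range k, 2 * k.choose j * N) *
    ((∏ j ∈ Finset.range (d - k), 2 * (d - k).choose (j + 1) * N) * 2 ^ (d + 1)))) (d + 1)]
  simp only [Finset.prod_mul_distrib, hP, hP', Finset.prod_const, Finset.card_range]
  rw [A, Finset.mul_sum, Finset.sum_mul]
  refine Finset.sum_congr rfl fun k hk => ?_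
  obtain ⟨e, rfl⟩ := Nat.exists_eq_add_of_le (Nat.lt_succ_iff.mp (Finset.mem_range.mp hk))
  rw [Nat.add_sub_cancel_left, show (4 : ℕ) = 2 * 2 from rfl, mul_pow]
  ring

theorem exists_cell {M N : ℕ} (hM : 0 < M) (hN : 0 < N) {x : ℝ} (hx : |x| ≤ M) :
    ∃ i : Fin (2 * M * N), (i : ℝ) ≤ N * (x + M) ∧ N * (x + M) ≤ i + 1 := by
  have hx' := abs_le.mp hx
  have hN' : (0 : ℝ) < N := by exact_mod_cast hN
  have h0 : 0 ≤ N * (x + M) := mul_nonneg hN'.le (by linarith)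
  have h1 : N * (x + M) ≤ (2 * M * N : ℕ) := by push_cast; nlinarith
  have hpos : 0 < 2 * M * N := by positivity
  by_cases h : ⌊N * (x + M)⌋₊ < 2 * M * N
  · exact ⟨⟨_, h⟩, Nat.floor_le h0, (Nat.lt_floor_add_one _).le⟩
  -- At the right endpoint `x = M` the floor is one too large; the last closed cell is used.
  · have h2 : ((2 * M * N : ℕ) : ℝ) ≤ N * (x + M) :=
      (Nat.cast_le.mpr (not_lt.mp h)).trans (Nat.floor_le h0)
    refine ⟨⟨2 * M * N - 1, by omega⟩, ?_, ?_⟩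
    · exact (Nat.cast_le.mpr (Nat.sub_le _ _)).trans h2
    · refine h1.trans (le_of_eq ?_)
      norm_cast
      simp only
      omega

theorem abs_sub_le_of_cell {N : ℕ} (hN : 0 < N) {M i x y : ℝ}
    (hx : i ≤ N * (x + M) ∧ N * (x + M) ≤ i + 1) (hy : i ≤ N * (y + M) ∧ N * (y + M) ≤ i + 1) :
    |x - y| ≤ 1 / N := by
  have hN' : (0 : ℝ) < N := by exact_mod_cast hN
  rw [abs_le, ← neg_div, div_le_iff₀ hN', le_div_iff₀ hN']
  constructor <;> linarith [hx.1, hx.2, hy.1, hy.2]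

/-- At most `s.card` terms of the convolution survive. In the application the two supports have
sizes `k` and `d - k`, which add up to `d`. -/
theorem abs_coeff_mul_le {p q : ℝ[X]} {s : Finset ℕ} {δ B : ℝ} (hδ : 0 ≤ δ)
    (hp : ∀ i ∈ s, |p.coeff i| ≤ δ) (hp' : ∀ i ∉ s, p.coeff i = 0) (hq : ∀ i, |q.coeff i| ≤ B)
    (m : ℕ) : |(p * q).coeff m| ≤ s.card * (δ * B) := by
  have hB : 0 ≤ B := (abs_nonneg _).trans (hq 0)
  rw [coeff_mul, Finset.Nat.sum_antidiagonal_eq_sum_range_succ_mk]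
  refine (Finset.abs_sum_le_sum_abs _ _).trans ?_
  calc ∑ i ∈ Finset.range (m + 1), |p.coeff i * q.coeff (m - i)|
      ≤ ∑ i ∈ Finset.range (m + 1), if i ∈ s then δ * B else 0 := by
        refine Finset.sum_le_sum fun i _ => ?_
        split_ifs with h
        · rw [abs_mul]
          exact mul_le_mul (hp i h) (hq _) (abs_nonneg _) hδ
        · simp [hp' i h]
    _ = ∑ i ∈ Finset.range (m + 1) with i ∈ s, δ * B := (Finset.sum_filter _ _).symm
    _ ≤ ∑ i ∈ s, δ * B := Finset.sum_le_sum_of_subset_of_nonneg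
        (fun i hi => (Finset.mem_filter.mp hi).2) fun _ _ _ => mul_nonneg hδ hB
    _ = s.card * (δ * B) := by rw [Finset.sum_const, nsmul_eq_mul]

/-- The cube with corner `z` contains the coefficient vector of a product of two factors that lie in
the cells prescribed by the label. -/
def HasLabel (d N : ℕ) (T : ℝ) (z : Fin (d + 1) → ℤ) (l : CubeLabel d N) : Prop :=
  ∃ g h : ℝ[X], g.Monic ∧ g.natDegree = l.1 ∧ h.coeff 0 = 1 ∧ h.natDegree ≤ d - l.1 ∧
    realMahler g = 1 ∧ realMahler h = 1 ∧
    (∀ j : Fin l.1, ((l.2.2.1 j : ℕ) : ℝ) ≤ N * (g.coeff j + ((l.1 : ℕ).choose j : ℕ)) ∧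
      N * (g.coeff j + ((l.1 : ℕ).choose j : ℕ)) ≤ (l.2.2.1 j : ℕ) + 1) ∧
    (∀ j : Fin (d - l.1),
      ((l.2.2.2.1 j : ℕ) : ℝ) ≤ N * (h.coeff (j + 1) + ((d - l.1).choose (j + 1) : ℕ)) ∧
      N * (h.coeff (j + 1) + ((d - l.1).choose (j + 1) : ℕ)) ≤ (l.2.2.2.1 j : ℕ) + 1) ∧
    (∀ i : Fin (d + 1), (z i : ℝ) ≤ (if l.2.1 then T else -T) * (g * h).coeff i ∧
      (if l.2.1 then T else -T) * (g * h).coeff i ≤ z i + 1) ∧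
    ∀ i, l.2.2.2.2 i = decide (Even (z i))

/-- Since the factors have measure one, `|c| = T`, so the sign determines `c`, and the binomial
coefficient bounds place every free coefficient in some cell. -/
theorem IsBoundaryCube.exists_hasLabel {d N : ℕ} (hN : 0 < N) {T : ℝ}
    {z : Fin (d + 1) → ℤ} (hz : IsBoundaryCube d T z) : ∃ l, HasLabel d N T z l := by
  obtain ⟨p, hp, hpT⟩ := hz
  obtain ⟨c, g, h, e, hg, hh, hg1, hh1, hdeg⟩ := hasSplitting (polyOfVec d p)
  have hd := hdeg.trans_le (natDegree_polyOfVec_le d p)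
  have hc : |c| = T := by
    rw [← hpT, e, realMahler_mul, realMahler_mul, hg1, hh1, mul_one, mul_one, realMahler_C]
  have hk : g.natDegree < d + 1 := by omega
  have hcell₁ : ∀ j : Fin g.natDegree, ∃ i : Fin (2 * g.natDegree.choose j * N),
      (i : ℝ) ≤ N * (g.coeff j + (g.natDegree.choose j : ℕ)) ∧
        N * (g.coeff j + (g.natDegree.choose j : ℕ)) ≤ i + 1 := fun j =>
    exists_cell (Nat.choose_pos j.2.le) hN
      (by simpa [hg1] using abs_coeff_le_choose_mul_realMahler (f := g) le_rfl j)
  have hcell₂ : ∀ j : Fin (d - g.natDegree),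
      ∃ i : Fin (2 * (d - g.natDegree).choose (j + 1) * N),
      (i : ℝ) ≤ N * (h.coeff (j + 1) + ((d - g.natDegree).choose (j + 1) : ℕ)) ∧
        N * (h.coeff (j + 1) + ((d - g.natDegree).choose (j + 1) : ℕ)) ≤ i + 1 := fun j =>
    exists_cell (Nat.choose_pos j.2) hN
      (by
        have hdk : h.natDegree ≤ d - g.natDegree := by omega
        simpa [hh1] using abs_coeff_le_choose_mul_realMahler hdk (j + 1))
  choose u hu using hcell₁
  choose v hv using hcell₂
  refine ⟨⟨⟨g.natDegree, hk⟩, decide (0 < c), u, v, fun i => decide (Even (z i))⟩,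
    g, h, hg, rfl, hh, ?_, hg1, hh1, hu, hv, fun i => ?_, fun i => rfl⟩
  · simp only; omega
  · have hs : (if decide (0 < c) = true then T else -T) = c := by
      by_cases h0 : 0 < c
      · simp [h0, ← hc, abs_of_pos h0]
      · simp [h0, ← hc, abs_of_nonpos (not_lt.mp h0)]
    have hpi : c * (g * h).coeff i = p i := by
      rw [← coeff_polyOfVec d p i, e, coeff_C_mul]
    simp only [hs, hpi]
    exact hp i

theorem choose_le_middle_of_le {n d : ℕ} (h : n ≤ d) (j : ℕ) : n.choose j ≤ d.choose (d / 2) :=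
  (Nat.choose_le_choose j h).trans (Nat.choose_le_middle j d)

/-- Equal cells force the two product points within distance less than 1 in each coordinate, so the
corners differ by at most 1 there; equal parities exclude a difference of 1. -/
theorem HasLabel.unique {d N : ℕ} {T : ℝ} (hT : 0 < T) (hN : T * (d * d.choose (d / 2)) < N)
    {z z' : Fin (d + 1) → ℤ} {l : CubeLabel d N} (h : HasLabel d N T z l)
    (h' : HasLabel d N T z' l) : z = z' := by
  have hN0 : (0 : ℝ) < N := lt_of_le_of_lt (by positivity) hN
  have hN1 : 0 < N := by exact_mod_cast hN0
  obtain ⟨⟨k, hk⟩, s, u, v, r⟩ := l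
  obtain ⟨g, f, gm, gd, f0, fd, g1, f1, gu, fv, hz, hr⟩ := h
  obtain ⟨g', f', gm', gd', f0', fd', g1', f1', gu', fv', hz', hr'⟩ := h'
  simp only at gd fd gu fv hz hr gd' fd' gu' fv' hz' hr'
  have hkd : k ≤ d := Nat.lt_succ_iff.mp hk
  have hdiff : ∀ m, |(g * f).coeff m - (g' * f').coeff m| ≤
      d * (1 / N * (d.choose (d / 2) : ℕ)) := fun m => by
    -- The difference `g - g'` lives in exponents below `k` (both are monic of degree `k`), and `f -
    -- f'` in exponents `1` to `d - k` (both have constant term 1).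
    have e : g * f - g' * f' = (g - g') * f + (f - f') * g' := by ring
    have hf : ∀ i, |f.coeff i| ≤ (d.choose (d / 2) : ℕ) := fun i => by
      refine (abs_coeff_le_choose_mul_realMahler fd i).trans ?_
      rw [f1, mul_one]
      exact_mod_cast choose_le_middle_of_le (Nat.sub_le d k) i
    have hg : ∀ i, |g'.coeff i| ≤ (d.choose (d / 2) : ℕ) := fun i => by
      refine (abs_coeff_le_choose_mul_realMahler gd'.le i).trans ?_
      rw [g1', mul_one]
      exact_mod_cast choose_le_middle_of_le hkd i
    have h₁ := abs_coeff_mul_le (p := g - g') (s := Finset.range k) (δ := 1 / N) (by positivity)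
      (fun i hi => by
        have hi := Finset.mem_range.mp hi
        rw [coeff_sub]
        exact abs_sub_le_of_cell hN1 (gu ⟨i, hi⟩) (gu' ⟨i, hi⟩))
      (fun i hi => by
        rw [coeff_sub]
        rcases (not_lt.mp (mt Finset.mem_range.mpr hi)).eq_or_lt with h | h
        · have a := gm.coeff_natDegree
          have b := gm'.coeff_natDegree
          rw [gd, h] at a
          rw [gd', h] at b
          rw [a, b, sub_self]
        · rw [coeff_eq_zero_of_natDegree_lt (by omega), coeff_eq_zero_of_natDegree_lt (by omega),
            sub_self]) hf m
    have h₂ := abs_coeff_mul_le (p := f - f') (s := Finset.Icc 1 (d - k)) (δ := 1 / N)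
      (by positivity)
      (fun i hi => by
        obtain ⟨h1, h2⟩ := Finset.mem_Icc.mp hi
        obtain ⟨j, rfl⟩ : ∃ j, i = j + 1 := ⟨i - 1, by omega⟩
        rw [coeff_sub]
        exact abs_sub_le_of_cell hN1 (fv ⟨j, h2⟩) (fv' ⟨j, h2⟩))
      (fun i hi => by
        rw [coeff_sub]
        rcases Nat.eq_zero_or_pos i with rfl | h
        · rw [f0, f0', sub_self]
        · rw [Finset.mem_Icc] at hi
          rw [coeff_eq_zero_of_natDegree_lt (by omega), coeff_eq_zero_of_natDegree_lt (by omega),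
            sub_self]) hg m
    rw [← coeff_sub, e, coeff_add]
    refine (abs_add_le _ _).trans ((add_le_add h₁ h₂).trans (le_of_eq ?_))
    rw [← add_mul, Finset.card_range, Nat.card_Icc, ← Nat.cast_add]
    congr 2
    omega
  funext i
  have hlt : |(if s then T else -T) * (g * f).coeff i - (if s then T else -T) * (g' * f').coeff i|
      < 1 := by
    rw [← mul_sub, abs_mul]
    have : |if s then T else -T| = T := by
      split_ifs <;> simp [abs_of_pos hT]
    rw [this]
    refine (mul_le_mul_of_nonneg_left (hdiff i) hT.le).trans_lt ?_
    rw [show T * (d * (1 / N * ((d.choose (d / 2) : ℕ) : ℝ))) =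
      T * (d * d.choose (d / 2)) / N by ring]
    exact (div_lt_one hN0).mpr hN
  obtain ⟨l1, l2⟩ := abs_lt.mp hlt
  have a : (z i : ℝ) < z' i + 2 := by linarith [hz i, hz' i]
  have b : (z' i : ℝ) < z i + 2 := by linarith [hz i, hz' i]
  have a' : z i < z' i + 2 := by exact_mod_cast a
  have b' : z' i < z i + 2 := by exact_mod_cast b
  have hpar : Even (z i) ↔ Even (z' i) := by
    have := (hr i).symm.trans (hr' i)
    simpa using this
  rw [Int.even_iff, Int.even_iff] at hpar
  omega

theorem boundaryCubes_finite_and_ncard_le (d : ℕ) {T : ℝ} (hT : 1 ≤ T) :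
    {z | IsBoundaryCube d T z}.Finite ∧
      ({z | IsBoundaryCube d T z}.ncard : ℝ) ≤ kappa0 d * T ^ d := by
  have hT0 : 0 < T := one_pos.trans_le hT
  set L : ℝ := d * d.choose (d / 2) with hL
  set N := ⌊T * L⌋₊ + 1 with hN
  have hLN : T * L < N := by rw [hN]; push_cast; exact Nat.lt_floor_add_one _
  have hex : ∀ z : {z | IsBoundaryCube d T z}, ∃ l, HasLabel d N T z.1 l := fun z =>
    IsBoundaryCube.exists_hasLabel (Nat.succ_pos _) z.2
  choose φ hφ using hex
  have hinj : Function.Injective φ := fun a b hab =>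
    Subtype.ext (HasLabel.unique hT0 hLN (hφ a) (hab ▸ hφ b))
  have := Finite.of_injective φ hinj
  refine ⟨Set.toFinite _, ?_⟩
  have hcard : {z | IsBoundaryCube d T z}.ncard ≤ 4 ^ (d + 1) * A d * N ^ d := by
    rw [← card_cubeLabel, ← Nat.card_eq_fintype_card]
    exact Nat.card_le_card_of_injective φ hinj
  -- Here `1 ≤ T` absorbs the rounding term.
  have hN' : (N : ℝ) ≤ T * (L + 1) := by
    rw [hN]; push_cast
    linarith [Nat.floor_le (show 0 ≤ T * L by positivity)]
  calc ({z | IsBoundaryCube d T z}.ncard : ℝ) ≤ (4 ^ (d + 1) * A d * N ^ d : ℕ) := by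
        exact_mod_cast hcard
    _ = 4 ^ (d + 1) * A d * (N : ℝ) ^ d := by push_cast; rfl
    _ ≤ 4 ^ (d + 1) * A d * (T * (L + 1)) ^ d := by gcongr
    _ = kappa0 d * T ^ d := by rw [kappa0, hL, mul_pow]; push_cast; ring

/-! ### Lattice points versus volume -/

/-- The half-open unit cube with integer corner `z`. -/
def latticeCube {ι : Type*} (z : ι → ℤ) : Set (ι → ℝ) :=
  Set.univ.pi fun i => Set.Ico (z i : ℝ) (z i + 1)

theorem mem_latticeCube {ι : Type*} {z : ι → ℤ} {x : ι → ℝ} :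
    x ∈ latticeCube z ↔ (fun i => ⌊x i⌋) = z := by
  simp [latticeCube, Set.mem_pi, funext_iff, Int.floor_eq_iff]

theorem intCast_mem_latticeCube {ι : Type*} (z : ι → ℤ) : (fun i => (z i : ℝ)) ∈ latticeCube z :=
  mem_latticeCube.mpr (by simp)

theorem volume_latticeCube {ι : Type*} [Fintype ι] (z : ι → ℤ) : volume (latticeCube z) = 1 := by
  simp [latticeCube, Real.volume_pi_Ico]

theorem measurableSet_latticeCube {ι : Type*} [Fintype ι] (z : ι → ℤ) :
    MeasurableSet (latticeCube z) :=
  MeasurableSet.univ_pi fun _ => measurableSet_Ico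

theorem finite_latticeCube_inter {ι : Type*} [Fintype ι] {S : Set (ι → ℝ)}
    (hS : Bornology.IsBounded S) : {z : ι → ℤ | (S ∩ latticeCube z).Nonempty}.Finite := by
  classical
  obtain ⟨R, hR⟩ := hS.exists_norm_le
  refine (Set.finite_Icc (fun _ : ι => ⌊-R⌋) (fun _ => ⌊R⌋)).subset ?_
  rintro z ⟨x, hx, hxz⟩
  rw [← mem_latticeCube.mp hxz]
  have h : ∀ i, |x i| ≤ R := fun i => (norm_le_pi_norm x i).trans (hR x hx)
  exact ⟨fun i => Int.floor_mono (abs_le.mp (h i)).1, fun i => Int.floor_mono (abs_le.mp (h i)).2⟩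

/-- The number of lattice points of a bounded set differs from its volume by at most the number of
unit cubes which meet both the set and its complement. -/
theorem abs_ncard_sub_volume_le {ι : Type*} [Fintype ι] {S : Set (ι → ℝ)}
    (hS : Bornology.IsBounded S) (hm : MeasurableSet S) {B : Set (ι → ℤ)} (hB : B.Finite)
    (h : ∀ z, (S ∩ latticeCube z).Nonempty → (latticeCube z \ S).Nonempty → z ∈ B) :
    |(({z : ι → ℤ | (fun i => (z i : ℝ)) ∈ S}.ncard : ℝ)) - (volume S).toReal| ≤ B.ncard := by
  classical
  set F := (finite_latticeCube_inter hS).toFinset with hF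
  have hmemF : ∀ z, z ∈ F ↔ (S ∩ latticeCube z).Nonempty := fun z => by simp [hF]
  have hvol : (volume S).toReal = ∑ z ∈ F, (volume (S ∩ latticeCube z)).toReal := by
    rw [← ENNReal.toReal_sum fun z _ =>
      ((measure_mono Set.inter_subset_right).trans_lt
        ((volume_latticeCube z).trans_lt ENNReal.one_lt_top)).ne, ← measure_biUnion_finset]
    · congr 2
      ext x
      simp only [Set.mem_iUnion, Set.mem_inter_iff, exists_prop, hmemF]
      refine ⟨fun hx => ⟨fun i => ⌊x i⌋, ⟨x, hx, mem_latticeCube.mpr rfl⟩, hx,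
        mem_latticeCube.mpr rfl⟩, ?_⟩
      rintro ⟨_, _, hx, _⟩
      exact hx
    · intro z _ w _ hzw
      refine Set.disjoint_left.mpr fun x hx hx' => hzw ?_
      rw [← mem_latticeCube.mp hx.2, mem_latticeCube.mp hx'.2]
    · exact fun z _ => hm.inter (measurableSet_latticeCube z)
  have hcount : ({z : ι → ℤ | (fun i => (z i : ℝ)) ∈ S}.ncard : ℝ) =
      ∑ z ∈ F, if (fun i => (z i : ℝ)) ∈ S then 1 else 0 := by
    rw [Finset.sum_boole, ← Set.ncard_coe_finset]
    congr 2
    ext z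
    simp only [Finset.coe_filter, hmemF]
    exact ⟨fun hz => ⟨⟨_, hz, intCast_mem_latticeCube z⟩, hz⟩, fun hz => hz.2⟩
  rw [hvol, hcount, ← Finset.sum_sub_distrib]
  refine (Finset.abs_sum_le_sum_abs _ _).trans ?_
  calc ∑ z ∈ F, |(if (fun i => (z i : ℝ)) ∈ S then (1 : ℝ) else 0) -
          (volume (S ∩ latticeCube z)).toReal|
      ≤ ∑ z ∈ F, if z ∈ B then (1 : ℝ) else 0 := by
        refine Finset.sum_le_sum fun z hz => ?_
        have hle : (volume (S ∩ latticeCube z)).toReal ≤ 1 := by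
          refine ENNReal.toReal_le_of_le_ofReal zero_le_one ?_
          rw [ENNReal.ofReal_one, ← volume_latticeCube z]
          exact measure_mono Set.inter_subset_right
        have h0 : 0 ≤ (volume (S ∩ latticeCube z)).toReal := ENNReal.toReal_nonneg
        by_cases hzB : z ∈ B
        · rw [if_pos hzB, abs_le]
          split_ifs <;> constructor <;> linarith
        · have hsub : latticeCube z ⊆ S := by
            by_contra hc
            exact hzB (h z ((hmemF z).mp hz) (Set.not_subset.mp hc))
          rw [if_neg hzB, if_pos (hsub (intCast_mem_latticeCube z)),
            Set.inter_eq_self_of_subset_right hsub, volume_latticeCube]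
          simp
    _ = ((F.filter (· ∈ B)).card : ℝ) := Finset.sum_boole _ _
    _ ≤ B.ncard := by
        rw [← Set.ncard_coe_finset]
        exact_mod_cast Set.ncard_le_ncard
          (fun z hz => (Finset.mem_filter.mp (Finset.mem_coe.mp hz)).2) hB

/-! ### Integer polynomials as lattice points of the dilated star body -/

/-- Coefficient vectors of Mahler measure at most `T`. -/
def starBody (d : ℕ) (T : ℝ) : Set (Fin (d + 1) → ℝ) := {w | realMahler (polyOfVec d w) ≤ T}

theorem polyOfVec_smul (d : ℕ) (c : ℝ) (w : Fin (d + 1) → ℝ) :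
    polyOfVec d (c • w) = C c * polyOfVec d w := by
  simp [polyOfVec, Finset.mul_sum, mul_assoc]

open scoped Pointwise in
theorem starBody_eq_smul (d : ℕ) {T : ℝ} (hT : 0 < T) : starBody d T = T • unitStarBody d := by
  ext w
  rw [Set.mem_smul_set_iff_inv_smul_mem₀ hT.ne']
  change realMahler _ ≤ T ↔ realMahler _ ≤ 1
  rw [polyOfVec_smul, realMahler_mul, realMahler_C, abs_inv, abs_of_pos hT, inv_mul_le_iff₀ hT,
    mul_one]

theorem volume_starBody (d : ℕ) {T : ℝ} (hT : 0 < T) :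
    (volume (starBody d T)).toReal = V d * T ^ (d + 1) := by
  rw [starBody_eq_smul d hT, Measure.addHaar_smul, ENNReal.toReal_mul, Module.finrank_fin_fun,
    abs_of_pos (by positivity), ENNReal.toReal_ofReal (by positivity), V, mul_comm]

theorem abs_le_of_mem_starBody {d : ℕ} {T : ℝ} {w : Fin (d + 1) → ℝ} (hw : w ∈ starBody d T)
    (i : Fin (d + 1)) : |w i| ≤ d.choose i * T := by
  rw [← coeff_polyOfVec d w i]
  exact (abs_coeff_le_choose_mul_realMahler (natDegree_polyOfVec_le d w) i).trans
    (mul_le_mul_of_nonneg_left hw (Nat.cast_nonneg _))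

theorem isBounded_starBody (d : ℕ) (T : ℝ) : Bornology.IsBounded (starBody d T) := by
  refine (Metric.isBounded_Icc (fun i : Fin (d + 1) => -((d.choose i : ℝ) * T))
    (fun i => (d.choose i : ℝ) * T)).subset fun w hw => ?_
  exact ⟨fun i => (abs_le.mp (abs_le_of_mem_starBody hw i)).1,
    fun i => (abs_le.mp (abs_le_of_mem_starBody hw i)).2⟩

theorem isClosed_starBody (d : ℕ) (T : ℝ) : IsClosed (starBody d T) :=
  isClosed_le (continuous_realMahler d) continuous_const

/-- A cube is convex, hence connected, so the intermediate value theorem applies to the continuous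
Mahler measure. -/
theorem isBoundaryCube_of_nonempty {d : ℕ} {T : ℝ} {z : Fin (d + 1) → ℤ}
    (h₁ : (starBody d T ∩ latticeCube z).Nonempty) (h₂ : (latticeCube z \ starBody d T).Nonempty) :
    IsBoundaryCube d T z := by
  obtain ⟨x, hx, hxz⟩ := h₁
  obtain ⟨y, hyz, hy⟩ := h₂
  have hconv : Convex ℝ (latticeCube z) := convex_pi fun i _ => convex_Ico _ _
  obtain ⟨p, hp, hpT⟩ := hconv.isPreconnected.intermediate_value hxz hyz
    (continuous_realMahler d).continuousOn (show T ∈ Set.Icc _ _ from ⟨hx, (not_le.mp hy).le⟩)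
  exact ⟨p, fun i => ⟨(hp i trivial).1, (hp i trivial).2.le⟩, hpT⟩

/-- Integer polynomials of degree at most `d` and Mahler measure at most `T`. -/
def boundedPolys (d : ℕ) (T : ℝ) : Set ℤ[X] :=
  {f | f.natDegree ≤ d ∧ (f.map (Int.castRingHom ℂ)).mahlerMeasure ≤ T}

theorem boundedPolys_finite (d : ℕ) (T : ℝ) : (boundedPolys d T).Finite :=
  (finite_mahlerMeasure_le d T.toNNReal).subset fun _ hf =>
    ⟨hf.1, hf.2.trans (Real.le_coe_toNNReal T)⟩

theorem polyOfVec_intCoeff {d : ℕ} {f : ℤ[X]} (hf : f.natDegree ≤ d) :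
    polyOfVec d (fun i => (f.coeff i : ℝ)) = f.map (Int.castRingHom ℝ) := by
  rw [polyOfVec, Fin.sum_univ_eq_sum_range (fun i => C (f.coeff i : ℝ) * X ^ i),
    as_sum_range_C_mul_X_pow' (f.map (Int.castRingHom ℝ))
      (Nat.lt_succ_of_le (natDegree_map_le.trans hf))]
  simp

theorem realMahler_intCoeff {d : ℕ} {f : ℤ[X]} (hf : f.natDegree ≤ d) :
    realMahler (polyOfVec d (fun i => (f.coeff i : ℝ))) =
      (f.map (Int.castRingHom ℂ)).mahlerMeasure := by
  rw [polyOfVec_intCoeff hf, realMahler, Polynomial.map_map]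
  congr 2

theorem ncard_boundedPolys (d : ℕ) (T : ℝ) :
    (boundedPolys d T).ncard =
      {z : Fin (d + 1) → ℤ | (fun i => (z i : ℝ)) ∈ starBody d T}.ncard := by
  refine Set.ncard_congr (fun f _ i => f.coeff i) (fun f hf => ?_) (fun f g hf hg h => ?_)
    fun z hz => ?_
  · exact (realMahler_intCoeff hf.1).trans_le hf.2
  · ext n
    by_cases hn : n < d + 1
    · exact congrFun h ⟨n, hn⟩
    · rw [coeff_eq_zero_of_natDegree_lt (hf.1.trans_lt (by omega)),
        coeff_eq_zero_of_natDegree_lt (hg.1.trans_lt (by omega))]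
  · have hdeg : (∑ i : Fin (d + 1), C (z i) * X ^ (i : ℕ)).natDegree ≤ d :=
      natDegree_sum_le_of_forall_le _ _ fun j _ =>
        (natDegree_C_mul_X_pow_le _ _).trans (Nat.lt_succ_iff.mp j.2)
    have hcoeff : (fun i : Fin (d + 1) => (∑ j : Fin (d + 1), C (z j) * X ^ (j : ℕ)).coeff i) = z :=
      funext fun i => by
        simp only [finsetSum_coeff, coeff_C_mul_X_pow]
        rw [Finset.sum_eq_single i] <;> simp +contextual [Fin.ext_iff, eq_comm]
    generalize (∑ i : Fin (d + 1), C (z i) * X ^ (i : ℕ)) = f at hdeg hcoeff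
    subst hcoeff
    exact ⟨f, ⟨hdeg, (realMahler_intCoeff hdeg).symm.trans_le hz⟩, rfl⟩

/-- The number of integer polynomials of degree at most `d` and Mahler measure at most `T` is
`V d * T ^ (d + 1)` up to an error of at most `kappa0 d * T ^ d`. -/
theorem abs_ncard_boundedPolys_sub_le (d : ℕ) {T : ℝ} (hT : 1 ≤ T) :
    |((boundedPolys d T).ncard : ℝ) - V d * T ^ (d + 1)| ≤ kappa0 d * T ^ d := by
  obtain ⟨hfin, hle⟩ := boundaryCubes_finite_and_ncard_le d hT
  rw [ncard_boundedPolys, ← volume_starBody d (one_pos.trans_le hT)]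
  exact (abs_ncard_sub_volume_le (isBounded_starBody d T) (isClosed_starBody d T).measurableSet hfin
    fun z => isBoundaryCube_of_nonempty).trans hle

theorem V_nonneg (d : ℕ) : 0 ≤ V d := ENNReal.toReal_nonneg

/-- The body lies in a box of volume `2 ^ (d + 1) * P d`, and `P d` is a summand of `A d`. This
controls the tail `n > T` of the Möbius series. -/
theorem V_le_kappa0 (d : ℕ) : V d ≤ kappa0 d := by
  have h₁ : volume (unitStarBody d) ≤
      volume (Set.Icc (fun i : Fin (d + 1) => -(d.choose i : ℝ)) fun i => (d.choose i : ℝ)) := by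
    refine measure_mono fun w hw => ?_
    have h : ∀ i, |w i| ≤ d.choose i := fun i => by
      simpa using abs_le_of_mem_starBody (T := 1) hw i
    exact ⟨fun i => (abs_le.mp (h i)).1, fun i => (abs_le.mp (h i)).2⟩
  rw [Real.volume_Icc_pi] at h₁
  have h₂ : V d ≤ ∏ i : Fin (d + 1), ((d.choose i : ℝ) - -(d.choose i : ℝ)) := by
    refine (ENNReal.toReal_mono (ENNReal.prod_ne_top fun i _ => ENNReal.ofReal_ne_top) h₁).trans
      (le_of_eq ?_)
    rw [ENNReal.toReal_prod]
    exact Finset.prod_congr rfl fun i _ => ENNReal.toReal_ofReal (by simp)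
  have h₃ : ∏ i : Fin (d + 1), ((d.choose i : ℝ) - -(d.choose i : ℝ)) =
      (2 ^ (d + 1) * P d : ℕ) := by
    rw [Fin.prod_univ_eq_prod_range (fun i => (d.choose i : ℝ) - -(d.choose i : ℝ)) (d + 1)]
    simp only [sub_neg_eq_add, ← two_mul, Finset.prod_mul_distrib, P]
    simp
  have h₄ : P d ≤ A d := by
    refine le_trans (by simp [P]) (Finset.single_le_sum (f := fun k => P k * P (d - k))
      (fun _ _ => Nat.zero_le _) (Finset.self_mem_range_succ d))
  refine (h₂.trans_eq h₃).trans (Nat.cast_le.mpr ?_)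
  rw [kappa0]
  calc 2 ^ (d + 1) * P d ≤ 4 ^ (d + 1) * A d :=
        Nat.mul_le_mul (Nat.pow_le_pow_left (by norm_num) _) h₄
    _ ≤ _ := Nat.le_mul_of_pos_right _ (by positivity)

/-! ### Primitive polynomials by Möbius inversion -/

/-- Primitive integer polynomials of degree at most `d` and Mahler measure at most `T`. -/
def primitiveBoundedPolys (d : ℕ) (T : ℝ) : Set ℤ[X] := {f ∈ boundedPolys d T | f.IsPrimitive}

theorem mahlerMeasure_map_C_natCast_mul (n : ℕ) (g : ℤ[X]) :
    ((C (n : ℤ) * g).map (Int.castRingHom ℂ)).mahlerMeasure =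
      n * (g.map (Int.castRingHom ℂ)).mahlerMeasure := by
  rw [Polynomial.map_mul, map_C, mahlerMeasure_mul, mahlerMeasure_const]
  simp

theorem ncard_multiples_boundedPolys (d : ℕ) (T : ℝ) {n : ℕ} (hn : 0 < n) :
    {f ∈ boundedPolys d T \ {0} | C (n : ℤ) ∣ f}.ncard = (boundedPolys d (T / n) \ {0}).ncard := by
  have hn' : (n : ℤ) ≠ 0 := by exact_mod_cast hn.ne'
  have hnR : (0 : ℝ) < n := by exact_mod_cast hn
  have hC : C (n : ℤ) ≠ 0 := C_ne_zero.mpr hn'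
  have key : ∀ g : ℤ[X], C (n : ℤ) * g ∈ boundedPolys d T \ {0} ↔
      g ∈ boundedPolys d (T / n) \ {0} := fun g => by
    simp only [boundedPolys, Set.mem_sdiff, Set.mem_ofPred_eq, Set.mem_singleton_iff, mul_eq_zero,
      hC, false_or, natDegree_C_mul hn', mahlerMeasure_map_C_natCast_mul, le_div_iff₀ hnR,
      mul_comm (mahlerMeasure _)]
  rw [← Set.ncard_image_of_injective (boundedPolys d (T / n) \ {0}) (mul_right_injective₀ hC)]
  congr 1
  ext f
  constructor
  · rintro ⟨hf, g, rfl⟩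
    exact ⟨g, (key g).mp hf, rfl⟩
  · rintro ⟨g, hg, rfl⟩
    exact ⟨(key g).mpr hg, dvd_mul_right _ _⟩

/-- A nonzero integer polynomial has measure at least 1. Hence the Möbius sum stops at `⌊T⌋₊`. -/
theorem natCast_le_of_C_dvd {d n : ℕ} {T : ℝ} {f : ℤ[X]} (hf : f ∈ boundedPolys d T \ {0})
    (h : C (n : ℤ) ∣ f) : (n : ℝ) ≤ T := by
  obtain ⟨g, rfl⟩ := h
  have hg : g ≠ 0 := by
    rintro rfl
    exact hf.2 (mul_zero _)
  have h₁ := hf.1.2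
  rw [mahlerMeasure_map_C_natCast_mul] at h₁
  exact (le_mul_of_one_le_right (Nat.cast_nonneg n) (one_le_mahlerMeasure_of_ne_zero hg)).trans h₁

theorem sum_divisors_moebius_eq (m : ℕ) :
    ∑ i ∈ m.divisors, ArithmeticFunction.moebius i = if m = 1 then 1 else 0 := by
  rw [← ArithmeticFunction.coe_mul_zeta_apply, ArithmeticFunction.moebius_mul_coe_zeta,
    ArithmeticFunction.one_apply]

theorem ncard_primitiveBoundedPolys (d : ℕ) (T : ℝ) :
    ((primitiveBoundedPolys d T).ncard : ℤ) = ∑ n ∈ Finset.Icc 1 ⌊T⌋₊,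
      ArithmeticFunction.moebius n * (boundedPolys d (T / n) \ {0}).ncard := by
  classical
  have hfin := (boundedPolys_finite d T).sdiff (t := {0})
  set F := hfin.toFinset with hF
  have hmem : ∀ f, f ∈ F ↔ f ∈ boundedPolys d T \ {0} := fun f => hfin.mem_toFinset
  have h₁ : primitiveBoundedPolys d T = (F.filter fun f => f.content.natAbs = 1 : Finset ℤ[X]) := by
    ext f
    rw [Finset.mem_coe, Finset.mem_filter, hmem, primitiveBoundedPolys, Set.mem_sep_iff,
      Int.natAbs_eq_iff, isPrimitive_iff_content_eq_one]
    constructor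
    · rintro ⟨hf, hc⟩
      refine ⟨⟨hf, ?_⟩, Or.inl hc⟩
      rintro rfl
      simp at hc
    · rintro ⟨hf, hc⟩
      refine ⟨hf.1, ?_⟩
      -- The content is normalized, which excludes the value -1.
      have := (normalize_content (p := f)).symm
      rcases hc with h | h
      · exact h
      · rw [h, ← Int.abs_eq_normalize] at this
        norm_num at this
  have h₂ : ∀ n ∈ Finset.Icc 1 ⌊T⌋₊, (boundedPolys d (T / n) \ {0}).ncard =
      (F.filter fun f => n ∣ f.content.natAbs).card := fun n hn => by
    rw [← ncard_multiples_boundedPolys d T (Finset.mem_Icc.mp hn).1, ← Set.ncard_coe_finset]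
    congr 1
    ext f
    rw [Finset.mem_coe, Finset.mem_filter, hmem, Set.mem_sep_iff, ← Int.natCast_dvd,
      dvd_content_iff_C_dvd]
  rw [h₁, Set.ncard_coe_finset, Finset.card_filter, Nat.cast_sum]
  have h₂' : ∀ n ∈ Finset.Icc 1 ⌊T⌋₊,
      ArithmeticFunction.moebius n * ((boundedPolys d (T / n) \ {0}).ncard : ℤ) =
        ∑ f ∈ F, ArithmeticFunction.moebius n *
          ((if n ∣ f.content.natAbs then 1 else 0 : ℕ) : ℤ) := fun n hn => by
    rw [h₂ n hn, Finset.card_filter, Nat.cast_sum, Finset.mul_sum]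
  rw [Finset.sum_congr rfl h₂', Finset.sum_comm]
  refine Finset.sum_congr rfl fun f hf => ?_
  have hf' := (hmem f).mp hf
  have h₃ : f.content.natAbs.divisors =
      (Finset.Icc 1 ⌊T⌋₊).filter fun n => n ∣ f.content.natAbs := by
    ext n
    have hc : f.content.natAbs ≠ 0 := by
      rw [Int.natAbs_ne_zero, Ne, content_eq_zero_iff]
      exact hf'.2
    rw [Nat.mem_divisors, Finset.mem_filter, Finset.mem_Icc]
    refine ⟨fun h => ⟨⟨Nat.pos_of_dvd_of_pos h.1 (Nat.pos_of_ne_zero hc), Nat.le_floor ?_⟩, h.1⟩,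
      fun h => ⟨h.2, hc⟩⟩
    exact natCast_le_of_C_dvd hf' (dvd_content_iff_C_dvd.mp (Int.natCast_dvd.mpr h.1))
  have h₄ := sum_divisors_moebius_eq f.content.natAbs
  rw [h₃, Finset.sum_filter] at h₄
  simpa using h₄.symm

theorem hasSum_one_div_pow_zeta {k : ℕ} (hk : 2 ≤ k) :
    HasSum (fun n : ℕ => 1 / (n : ℝ) ^ k) (riemannZeta k).re := by
  have h := (Real.summable_one_div_nat_pow.mpr (show 1 < k by omega)).hasSum
  have : riemannZeta k = ((∑' n : ℕ, 1 / (n : ℝ) ^ k : ℝ) : ℂ) := by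
    rw [zeta_nat_eq_tsum_of_gt_one (by omega), Complex.ofReal_tsum]
    push_cast
    rfl
  rwa [this, Complex.ofReal_re]

theorem riemannZeta_natCast_eq_re {k : ℕ} (hk : 2 ≤ k) :
    riemannZeta k = ((riemannZeta k).re : ℂ) := by
  have : riemannZeta k = ((∑' n : ℕ, 1 / (n : ℝ) ^ k : ℝ) : ℂ) := by
    rw [zeta_nat_eq_tsum_of_gt_one (by omega), Complex.ofReal_tsum]
    push_cast
    rfl
  rw [this, Complex.ofReal_re]

theorem hasSum_moebius_div_pow {k : ℕ} (hk : 2 ≤ k) :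
    HasSum (fun n : ℕ => (ArithmeticFunction.moebius n : ℝ) / (n : ℝ) ^ k)
      (riemannZeta k).re⁻¹ := by
  have hk' : 1 < (k : ℂ).re := by
    rw [Complex.natCast_re]
    exact_mod_cast hk
  have h := (ArithmeticFunction.LSeriesSummable_moebius_iff.mpr hk').hasSum
  have hL := LSeries_one_mul_Lseries_moebius hk'
  rw [LSeries_one_eq_riemannZeta hk', riemannZeta_natCast_eq_re hk] at hL
  rw [← Complex.hasSum_ofReal, Complex.ofReal_inv, ← eq_inv_of_mul_eq_one_right hL]
  refine h.congr_fun ?_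
  intro n
  rw [LSeries.term_def]
  split_ifs with hn
  · simp [hn]
  · simp

/-- The finite Möbius sum, extended by zero, is compared termwise with the series for `1 / ζ(d +
1)`. -/
theorem abs_ncard_primitiveBoundedPolys_sub_le {d : ℕ} (hd : 2 ≤ d) {T : ℝ} (hT : 1 ≤ T) :
    |((primitiveBoundedPolys d T).ncard : ℝ) -
        V d / (riemannZeta ((d : ℂ) + 1)).re * T ^ (d + 1)| ≤
      T + (riemannZeta (d : ℂ)).re * kappa0 d * T ^ d := by
  have hT0 : 0 ≤ T := zero_le_one.trans hT
  set s := Finset.Icc 1 ⌊T⌋₊ with hs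
  set a : ℕ → ℝ := fun n => if n ∈ s then
    (ArithmeticFunction.moebius n : ℝ) * (boundedPolys d (T / n) \ {0}).ncard else 0 with ha
  set b : ℕ → ℝ := fun n => V d * T ^ (d + 1) *
    ((ArithmeticFunction.moebius n : ℝ) / (n : ℝ) ^ (d + 1)) with hb
  have hasum : HasSum a (primitiveBoundedPolys d T).ncard := by
    have h : ((primitiveBoundedPolys d T).ncard : ℝ) = ∑ n ∈ s, a n := by
      rw [← Int.cast_natCast, ncard_primitiveBoundedPolys, Int.cast_sum]
      refine Finset.sum_congr rfl fun n hn => ?_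
      rw [ha]
      simp only [hn, if_true]
      push_cast
      rfl
    rw [h]
    exact hasSum_sum_of_ne_finset_zero fun n hn => if_neg hn
  have hbsum : HasSum b (V d / (riemannZeta ((d : ℂ) + 1)).re * T ^ (d + 1)) := by
    have h := (hasSum_moebius_div_pow (k := d + 1) (by omega)).mul_left (V d * T ^ (d + 1))
    rw [Nat.cast_add_one] at h
    rwa [div_eq_mul_inv, mul_right_comm]
  have hgsum : HasSum (fun n : ℕ => (kappa0 d * T ^ d * (1 / (n : ℝ) ^ d) +
      if n ∈ s then (1 : ℝ) else 0)) (kappa0 d * T ^ d * (riemannZeta (d : ℂ)).re + ⌊T⌋₊) := by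
    refine ((hasSum_one_div_pow_zeta hd).mul_left _).add ?_
    have h : (⌊T⌋₊ : ℝ) = ∑ n ∈ s, if n ∈ s then (1 : ℝ) else 0 := by
      rw [Finset.sum_ite_mem, Finset.inter_self, Finset.sum_const, hs, Nat.card_Icc]
      simp
    rw [h]
    exact hasSum_sum_of_ne_finset_zero fun n hn => if_neg hn
  have hbound : ∀ n, ‖a n - b n‖ ≤ kappa0 d * T ^ d * (1 / (n : ℝ) ^ d) +
      if n ∈ s then (1 : ℝ) else 0 := fun n => by
    have hμ : |(ArithmeticFunction.moebius n : ℝ)| ≤ 1 := by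
      exact_mod_cast ArithmeticFunction.abs_moebius_le_one (n := n)
    have hbn : b n = ArithmeticFunction.moebius n * (V d * (T / n) ^ (d + 1)) := by
      rw [hb, div_pow]; ring
    have hκ : kappa0 d * T ^ d * (1 / (n : ℝ) ^ d) = kappa0 d * (T / n) ^ d := by
      rw [div_pow]; ring
    rw [Real.norm_eq_abs, hbn, hκ]
    rcases Nat.eq_zero_or_pos n with rfl | hn
    -- Both sides vanish at `n = 0`, as `T / 0 = 0` and the Möbius function is 0 there.
    · simp [ha, hs, show d ≠ 0 by omega]
    have hnR : (0 : ℝ) < n := by exact_mod_cast hn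
    by_cases hns : n ∈ s
    · have hnT : (1 : ℝ) ≤ T / n := by
        rw [one_le_div hnR]
        exact (Nat.le_floor_iff hT0).mp (Finset.mem_Icc.mp hns).2
      have h0 : (0 : ℤ[X]) ∈ boundedPolys d (T / n) := ⟨by simp, by simp; positivity⟩
      have hcard : ((boundedPolys d (T / n) \ {0}).ncard : ℝ) =
          (boundedPolys d (T / n)).ncard - 1 := by
        rw [← Set.ncard_sdiff_singleton_add_one h0 (boundedPolys_finite d _)]
        push_cast
        ring
      simp only [ha, hns, if_true]
      rw [← mul_sub, abs_mul, hcard]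
      refine (mul_le_of_le_one_left (abs_nonneg _) hμ).trans ?_
      rw [sub_right_comm]
      refine (abs_sub _ _).trans ?_
      rw [abs_one]
      gcongr
      exact abs_ncard_boundedPolys_sub_le d hnT
    -- Only the series term is left; `T / n ≤ 1` lets one power be dropped, so the bound for `n ≤ T`
    -- covers the tail too.
    · have hnT : T / n ≤ 1 := by
        rw [div_le_one hnR]
        by_contra hc
        exact hns (Finset.mem_Icc.mpr ⟨hn, Nat.le_floor (not_le.mp hc).le⟩)
      have hq : 0 ≤ T / n := by positivity
      simp only [ha, hns, if_false, zero_sub, abs_neg, add_zero]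
      rw [abs_mul, abs_of_nonneg (mul_nonneg (V_nonneg d) (pow_nonneg hq _))]
      refine (mul_le_of_le_one_left (mul_nonneg (V_nonneg d) (pow_nonneg hq _)) hμ).trans ?_
      exact mul_le_mul (V_le_kappa0 d) (pow_le_pow_of_le_one hq hnT (Nat.le_succ d))
        (pow_nonneg hq _) (Nat.cast_nonneg _)
  have h := tsum_of_norm_bounded hgsum hbound
  rw [(hasum.sub hbsum).tsum_eq, Real.norm_eq_abs] at h
  refine h.trans ?_
  linarith [Nat.floor_le hT0]

/-! ### From degree at most `d` to degree exactly `d` -/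

theorem ncard_boundedPolys_le (d : ℕ) {T : ℝ} (hT : 1 ≤ T) :
    ((boundedPolys d T).ncard : ℝ) ≤ Cmn 0 0 d * T ^ (d + 1) := by
  have hT0 : 0 ≤ T := zero_le_one.trans hT
  have h := card_mahlerMeasure_le_prod d ⟨T, hT0⟩
  have h' : ((boundedPolys d T).ncard : ℝ) ≤
      (∏ i : Fin (d + 1), (2 * ⌊d.choose i * (⟨T, hT0⟩ : NNReal)⌋₊ + 1) : ℕ) := by
    exact_mod_cast h
  refine h'.trans ?_
  have e : (Cmn 0 0 d : ℝ) * T ^ (d + 1) =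
      ∏ i : Fin (d + 1), ((2 * d.choose i + 1 : ℕ) : ℝ) * T := by
    rw [Finset.prod_mul_distrib, Fin.prod_univ_eq_prod_range
      (fun i => ((2 * d.choose i + 1 : ℕ) : ℝ)) (d + 1), Cmn, Nat.sub_zero,
      ← Nat.range_succ_eq_Icc_zero, Nat.cast_prod]
    simp
  rw [e, Nat.cast_prod]
  refine Finset.prod_le_prod (fun _ _ => Nat.cast_nonneg _) fun i _ => ?_
  have hfl : ((⌊d.choose i * (⟨T, hT0⟩ : NNReal)⌋₊ : ℕ) : ℝ) ≤ d.choose i * T := by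
    have := Nat.floor_le (zero_le (a := (d.choose i * (⟨T, hT0⟩ : NNReal))))
    exact_mod_cast this
  push_cast
  linarith

theorem M1_le_ncard_and_ncard_le (d : ℕ) (T : ℝ) :
    M1 d T ≤ (primitiveBoundedPolys d T).ncard ∧
      (primitiveBoundedPolys d T).ncard ≤ M1 d T + (boundedPolys (d - 1) T).ncard := by
  have hfin : (primitiveBoundedPolys d T).Finite :=
    (boundedPolys_finite d T).subset fun f hf => hf.1
  constructor
  · refine Set.ncard_le_ncard (fun f hf => ⟨⟨?_, hf.2.2⟩, hf.2.1⟩) hfin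
    exact (natDegree_eq_of_degree_eq_some hf.1).le
  · refine (Set.ncard_le_ncard ?_ ((primitivePolys_finite d T).union
      (boundedPolys_finite (d - 1) T))).trans (Set.ncard_union_le _ _)
    rintro f ⟨⟨hf, hm⟩, hp⟩
    rcases hf.eq_or_lt with h | h
    · exact Or.inl ⟨by rw [degree_eq_natDegree hp.ne_zero, h], hp, hm⟩
    · exact Or.inr ⟨Nat.le_sub_one_of_lt h, hm⟩

end MahlerCount

theorem mainTheorem12 (d : ℕ) (hd : 2 ≤ d) (T : ℝ) (hT : 1 ≤ T) :
    |(MahlerCount.M1 d T : ℝ) - MahlerCount.V d / (riemannZeta ((d : ℂ) + 1)).re * T ^ (d + 1)| ≤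
      (MahlerCount.V d / d + 1) * T +
        ((MahlerCount.Cmn 0 0 (d - 1) : ℝ) +
          (riemannZeta (d : ℂ)).re * (MahlerCount.kappa0 d : ℝ)) * T ^ d := by
  obtain ⟨h₁, h₂⟩ := MahlerCount.M1_le_ncard_and_ncard_le d T
  have h₁' : (MahlerCount.M1 d T : ℝ) ≤ (MahlerCount.primitiveBoundedPolys d T).ncard := by
    exact_mod_cast h₁
  have h₂' : ((MahlerCount.primitiveBoundedPolys d T).ncard : ℝ) ≤
      MahlerCount.M1 d T + (MahlerCount.boundedPolys (d - 1) T).ncard := by exact_mod_cast h₂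
  have h₃ := MahlerCount.ncard_boundedPolys_le (d - 1) hT
  rw [Nat.sub_add_cancel (show 1 ≤ d by omega)] at h₃
  have h₄ := abs_le.mp (MahlerCount.abs_ncard_primitiveBoundedPolys_sub_le hd hT)
  -- The tail is already inside the `ζ(d)` term, so this summand of the bound is mere slack.
  have h₅ : 0 ≤ MahlerCount.V d / d * T :=
    mul_nonneg (div_nonneg (MahlerCount.V_nonneg d) (Nat.cast_nonneg d)) (by linarith)
  have h₆ : (0 : ℝ) ≤ MahlerCount.Cmn 0 0 (d - 1) * T ^ d := by positivity
  rw [abs_le]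
  constructor <;> linarith [h₄.1, h₄.2]
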